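/- **Theorem 2.5.** For a topological space $X$ and a Hausdorff space $M$, let $E_0(X,M)$ be the set of continuous $f:X\to M$ such that the union of all open sets $U\subseteq X$ on which $f$ is constant is dense in $X$; let $E_0(X)=E_0(X,\mathbb R)$. Let $I$ be a set of cardinality $\mathfrak c=2^{\aleph_0}$, let $I^{<\omega}$ be the tree of finite sequences from $I$ (where $()$ is the empty sequence, $lh(s)$ is the length of $s$, and $s\alpha$ is $s$ with $\alpha$ appended), and let $\mathbb B=\ell^2(I^{<\omega})$ be the complex Hilbert space with standard orthonormal basis $\{e_s:s\in I^{<\omega}\}$. Let $\pi_n$ be the orthogonal projection of $\mathbb B$ onto the closed span of $\{e_s: lh(s)<n\}$. For $lh(s)=n$, let $D_s=\{\sum_{i\le n}z_ie_{s\restriction i}: |z_i|\le 2^{-i}\}$, where $s\restriction i$ is the initial segment of $s$ of length $i$. Then there are sets $K_t\subseteq\mathbb B$ $(t\in I^{<\omega})$ such that * $K_{()}=\{0\}$; * for each $s$, the $K_{s\alpha}$ $(\alpha\in I)$ are pairwise disjoint closed subsets of $D_s$, each homeomorphic to the Cantor set $2^\omega$, and $\langle x,e_s\rangle\neq0$ for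 all $x\in K_{s\alpha}$; * $\pi_{lh(s)}(K_{s\alpha})\subseteq K_s$ for all $s$ and $\alpha$; and such that the set $L_\omega$ of all $x\in\mathbb B$ satisfying 1. $|\langle x,e_s\rangle|\le2^{-lh(s)}$ for all $s$, 2. $\langle x,e_s\rangle=0$ or $\langle x,e_t\rangle=0$ whenever neither of $s,t$ is an initial segment of the other, 3. $\langle x,e_t\rangle=0$ or $\pi_{lh(t)}(x)\in K_t$, for all $t$, has the following properties: * for every $s$, $v\in K_s$ and $z\in\mathbb C$ with $|z|\le2^{-lh(s)}$, the vector $v+ze_s$ is in $L_\omega$ (so $L_\omega$ contains the disk $\{ze_{()}:|z|\le1\}$ and the disks attached at the points of all the $K_s$); * with the weak topology of $\mathbb B$, $L_\omega$ is compact (hence a uniform Eberlein compact space, that is, a weakly compact subset of a Hilbert space) and first countable; * every function in $E_0(L_\omega)$ is constant, and, for every Hausdorff space $M$, every function in $E_0(L_\omega,M)$ is constant. -/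

import Mathlib

open Set Topology

noncomputable section

/-- The union of all open sets on which `f` is constant. -/
def constancySet {X M : Type*} [TopologicalSpace X] (f : X → M) : Set X :=
  ⋃₀ {U : Set X | IsOpen U ∧ ∀ x ∈ U, ∀ y ∈ U, f x = f y}

/-- The continuous functions from `X` to `M` that are locally constant on a dense set. -/
def EZero (X M : Type*) [TopologicalSpace X] [TopologicalSpace M] : Set C(X, M) :=
  {f | Dense (constancySet f)}

/-- A Cantor set: a set that, as a subspace, is homeomorphic to `2^ω`. -/
def IsCantorSet {Y : Type*} [TopologicalSpace Y] (A : Set Y) : Prop :=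
  Nonempty (A ≃ₜ (ℕ → Bool))

/-- The complex Hilbert space `ℓ²(ι^{<ω})`.  Its standard orthonormal basis `e_s` is indexed by the
finite sequences `s` in `ι`, and the coordinate `x · e_s` of a vector `x` is `x s`. -/
abbrev TreeHilbert (ι : Type*) : Type _ := lp (fun _ : List ι => ℂ) 2

/-- The basis vector `e_s`. -/
def treeVec {ι : Type*} (s : List ι) : TreeHilbert ι :=
  open Classical in lp.single 2 s (1 : ℂ)

/-- The perpendicular projection `π_n` onto the closed span of the `e_s` with `lh(s) < n`:
it keeps the coordinates at sequences of length less than `n` and kills all others. -/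
def treeProj {ι : Type*} (n : ℕ) (x : TreeHilbert ι) : TreeHilbert ι :=
  ⟨fun s => if s.length < n then x s else 0, by
    have hx : Memℓp (fun s : List ι => x s) 2 := lp.memℓp x
    have h2 : 0 < (2 : ENNReal).toReal := by norm_num
    refine memℓp_gen ((hx.summable h2).of_nonneg_of_le (fun s => by positivity) fun s => ?_)
    split_ifs
    · exact le_rfl
    · rw [norm_zero, Real.zero_rpow h2.ne']
      positivity⟩

/-- The polydisk `D_s`: all `∑_{i ≤ lh(s)} z_i e_{s|i}` with `|z_i| ≤ 2^{-i}`.  The sequences `s|i`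
are the prefixes of `s`. -/
def treeDisk {ι : Type*} (s : List ι) : Set (TreeHilbert ι) :=
  {x | (∀ t, t <+: s → ‖x t‖ ≤ (2⁻¹ : ℝ) ^ t.length) ∧ ∀ t, ¬ t <+: s → x t = 0}

/-- The requirements on the family `K_t`, `t ∈ ι^{<ω}`, along which the disks are attached:
`K_() = {0}`; for each `s` the sets `K_{sα}` are pairwise disjoint closed Cantor subsets of `D_s` on
which the coordinate at `s` does not vanish; and `K_{sα}` projects into `K_s`. -/
structure IsCantorTree {ι : Type*} (K : List ι → Set (TreeHilbert ι)) : Prop where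
  root : K [] = {0}
  cantor : ∀ s α, IsCantorSet (K (s ++ [α]))
  closed : ∀ s α, IsClosed (K (s ++ [α]))
  disjoint : ∀ s α β, α ≠ β → Disjoint (K (s ++ [α])) (K (s ++ [β]))
  subset_disk : ∀ s α, K (s ++ [α]) ⊆ treeDisk s
  coord_ne_zero : ∀ s α, ∀ x ∈ K (s ++ [α]), x s ≠ 0
  proj_mem : ∀ s α, ∀ x ∈ K (s ++ [α]), treeProj s.length x ∈ K s

/-- The set `L_ω` of all vectors `x` such that: (1) `|x · e_s| ≤ 2^{-lh(s)}` for all `s`; (2) for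
incompatible `s, t`, one of the coordinates at `s`, `t` is zero; (3) for all `t`, the coordinate at
`t` is zero or `π_{lh(t)}(x) ∈ K_t`. -/
def LOmega {ι : Type*} (K : List ι → Set (TreeHilbert ι)) : Set (TreeHilbert ι) :=
  {x | (∀ s, ‖x s‖ ≤ (2⁻¹ : ℝ) ^ s.length) ∧
    (∀ s t, ¬ s <+: t → ¬ t <+: s → x s = 0 ∨ x t = 0) ∧
    ∀ t, x t = 0 ∨ treeProj t.length x ∈ K t}

/-- `L_ω` as a subset of the Hilbert space with its weak topology. -/
def LOmegaWeak {ι : Type*} (K : List ι → Set (TreeHilbert ι)) :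
    Set (WeakSpace ℂ (TreeHilbert ι)) :=
  toWeakSpace ℂ (TreeHilbert ι) '' LOmega K

end

/-!
The sets `K_s` are curves `branch s : 2^ω → ℓ²` built by recursion. The index set `ι` is identified
with the circle, and the curve for `sα` is drawn on the radii of direction `θ = α` of the disks
attached at the points of `K_s`: it is `c ↦ branch s (p c) + 2^{-n} ρ(c) θ e_s` with `p : 2^ω → 2^ω`
continuous and injective and `ρ : 2^ω → (0, 1]` continuous. Different directions give disjoint
curves, and the projection of a curve to the ones below it is injective, except at the root, where
everything is collapsed to `0`.

The pairs `(p, ρ)` are chosen so that every continuous real function that is not constant on all the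
disks at `s` is injective on uncountably many of the `K_{sα}` (`nonempty_curveSystem`). For this, the
circle is labelled by continuous functions so that each label occurs uncountably often in each open
arc (`exists_uncountable_dense_fibers`), and `(p, ρ)` is chosen for the function that labels `θ`
(`exists_injective_selection_of_lt`), by the perfect set theorem.

On `L_ω` the weak topology is that of coordinatewise convergence, in which `L_ω` is a closed subset of
a product of disks; hence it is compact (`nonempty_homeomorph_coordLOmega`). Each point is determined
in `L_ω` by countably many coordinates, so that by compactness `L_ω` is first countable
(`firstCountable_coordLOmega`).

Let `f` be a continuous real function on `L_ω`. By compactness, `f` depends on `π_n(x)` only on the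
open set `{x | x u ≠ 0}`, for all but countably many `u` of length `n` (`countable_setOf_ne_trunc`). If
`f` is not constant, it is not constant on some disk at some `s` (`eq_of_forall_disk`), so one such
`u = sα` can be found for which, in addition, `f` is injective on `K_u`
(`exists_injective_branch_of_ne`). Each nonempty open subset of `{x | x u ≠ 0}` contains two points
`v + z e_t` and `v' + z e_t` with `v ≠ v'` in `K_t`, where `t` extends `u`; their projections to `K_u`
are distinct, so `f` is not constant there, and `f` is not in `E_0` (`eq_of_mem_EZero`). The case of a
Hausdorff range follows by composing with real functions on the compact image.
-/

/-! ### Labelling the directions -/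

theorem mk_circle : Cardinal.mk Circle = Cardinal.continuum := by
  have h := Cardinal.mk_congr ((AddCircle.homeomorphCircle'.symm.toEquiv).trans
    (have : Fact (0 < 2 * Real.pi) := ⟨by positivity⟩; AddCircle.equivIco (2 * Real.pi) 0))
  rw [h, Cardinal.mk_Ico_real (by positivity)]

/-- A label map on the circle each of whose fibres meets every nonempty open set in an uncountable
set. The fibres are unions of uncountably many cosets of a countable dense subgroup. -/
theorem exists_uncountable_dense_fibers (Y : Type) [Nonempty Y]
    (hY : Cardinal.mk Y ≤ Cardinal.continuum) :
    ∃ lab : Circle → Y, ∀ y, ∀ U : Set Circle, IsOpen U → U.Nonempty →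
      ¬ {θ | θ ∈ U ∧ lab θ = y}.Countable := by
  let φ : Multiplicative ℚ →* Circle :=
    { toFun := fun q => Circle.exp ((Multiplicative.toAdd q : ℚ) : ℝ)
      map_one' := by simp
      map_mul' := fun a b => by simp [Circle.exp_add] }
  let H : Subgroup Circle := φ.range
  have hHc : (H : Set Circle).Countable := by
    have : (H : Set Circle) = range φ := MonoidHom.coe_range φ
    rw [this]
    have : Countable (Multiplicative ℚ) := inferInstanceAs (Countable ℚ)
    exact countable_range _
  have hHd : Dense (H : Set Circle) := by
    have h1 : DenseRange (fun q : ℚ => Circle.exp (q : ℝ)) :=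
      Circle.exp_surjective.denseRange.comp Rat.denseRange_cast Circle.exp.continuous
    refine h1.mono ?_
    rintro _ ⟨q, rfl⟩
    exact ⟨Multiplicative.ofAdd q, rfl⟩
  have hq : Cardinal.mk (Circle ⧸ H) = Cardinal.continuum := by
    have h := Cardinal.mk_congr (Subgroup.groupEquivQuotientProdSubgroup (s := H))
    rw [Cardinal.mk_prod, Cardinal.lift_id, Cardinal.lift_id, mk_circle] at h
    have hH : Cardinal.mk H ≤ Cardinal.aleph0 := Cardinal.mk_le_aleph0_iff.2 hHc.to_subtype
    refine le_antisymm (mk_circle ▸ Cardinal.mk_quotient_le) ?_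
    by_contra hlt
    rw [not_le] at hlt
    have h2 := Cardinal.mul_lt_of_lt Cardinal.aleph0_le_continuum hlt
      (hH.trans_lt Cardinal.aleph0_lt_continuum)
    rw [← h] at h2
    exact lt_irrefl _ h2
  have hle : Cardinal.mk (Y × ℝ) ≤ Cardinal.mk (Circle ⧸ H) := by
    rw [hq, Cardinal.mk_prod, Cardinal.lift_id, Cardinal.lift_id, Cardinal.mk_real]
    exact (mul_le_mul_left hY _).trans (Cardinal.continuum_mul_self).le
  obtain ⟨emb⟩ := Cardinal.le_def _ _ |>.1 hle
  let g : Circle ⧸ H → Y × ℝ := Function.invFun emb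
  have hg : Function.Surjective g := Function.invFun_surjective emb.injective
  refine ⟨fun θ => (g θ).1, fun y U hU hne hcount => ?_⟩
  have hpick : ∀ r : ℝ, ∃ θ : Circle, θ ∈ U ∧ g θ = (y, r) := by
    intro r
    obtain ⟨k, hk⟩ := hg (y, r)
    obtain ⟨x, rfl⟩ := QuotientGroup.mk_surjective k
    obtain ⟨u, hu⟩ := hne
    have hop : IsOpen ((fun h : Circle => x * h) ⁻¹' U) := hU.preimage (by fun_prop)
    obtain ⟨h, hh, hH⟩ := hHd.inter_open_nonempty _ hop ⟨x⁻¹ * u, by simpa using hu⟩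
    refine ⟨x * h, hh, ?_⟩
    rw [← hk]
    congr 1
    exact (QuotientGroup.mk_mul_of_mem x hH)
  choose θ hθU hθ using hpick
  have hinj : Function.Injective θ := fun a b hab => by
    have := (hθ a).symm.trans (hab ▸ hθ b)
    exact (Prod.ext_iff.1 this).2
  have : (range θ).Countable := hcount.mono (by
    rintro _ ⟨r, rfl⟩
    exact ⟨hθU r, by simp [hθ r]⟩)
  have h2 : (univ : Set ℝ).Countable := by
    rw [← image_univ] at this
    exact countable_of_injective_of_countable_image hinj.injOn this
  exact Cardinal.not_countable_real h2

/-- A separable space carries at most continuum many continuous real functions. -/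
theorem mk_continuousMap_real_le (X : Type) [TopologicalSpace X] [TopologicalSpace.SeparableSpace X]
    [Nonempty X] : Cardinal.mk C(X, ℝ) ≤ Cardinal.continuum := by
  have hinj : Function.Injective
      (fun (f : C(X, ℝ)) (n : ℕ) => f (TopologicalSpace.denseSeq X n)) := by
    intro f g hfg
    refine ContinuousMap.ext fun x => ?_
    have := (TopologicalSpace.denseRange_denseSeq X).equalizer f.continuous g.continuous hfg
    exact congrFun this x
  refine (Cardinal.mk_le_of_injective hinj).trans ?_
  simp [Cardinal.mk_real]

/-! ### Cantor sets on which a function is injective -/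

theorem exists_cantor_injection_Icc {a b : ℝ} (hab : a < b) :
    ∃ g : (ℕ → Bool) → ℝ, range g ⊆ Icc a b ∧ Continuous g ∧ Function.Injective g := by
  refine isClosed_Icc.exists_nat_bool_injection_of_not_countable fun h => ?_
  have := Cardinal.mk_le_aleph0_iff.2 h.to_subtype
  rw [Cardinal.mk_Icc_real hab] at this
  exact this.not_gt Cardinal.aleph0_lt_continuum

/-- Every neighbourhood of a point of the Cantor space is uncountable. -/
theorem not_countable_of_mem_nhds_cantor {c : ℕ → Bool} {V : Set (ℕ → Bool)} (hV : V ∈ 𝓝 c) :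
    ¬ V.Countable := by
  intro hcount
  let j : ℕ → (ℕ → Bool) → ℕ → Bool := fun m d i => if i < m then c i else d (i - m)
  have hev : ∃ m, ∀ d, j m d ∈ V := by
    obtain ⟨W, ⟨x, n, rfl⟩, hc, hW⟩ :=
      (PiNat.isTopologicalBasis_cylinders (fun _ : ℕ => Bool)).mem_nhds_iff.1 hV
    refine ⟨n, fun d => hW fun i hi => ?_⟩
    simp only [j, if_pos hi]
    exact hc i hi
  obtain ⟨m, hm⟩ := hev
  have hinj : Function.Injective (j m) := by
    intro d d' h
    funext i
    have := congrFun h (i + m)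
    simpa [j] using this
  have h1 : (univ : Set (ℕ → Bool)).Countable := by
    refine countable_of_injective_of_countable_image hinj.injOn (hcount.mono ?_)
    rintro _ ⟨d, -, rfl⟩
    exact hm d
  have h2 := Cardinal.mk_le_aleph0_iff.2 (countable_univ_iff.1 h1)
  simp only [Cardinal.mk_pi, Cardinal.mk_bool, Cardinal.prod_const] at h2
  simp at h2
  exact h2.not_gt Cardinal.aleph0_lt_continuum

instance cantor_polishSpace : PolishSpace (ℕ → Bool) := by
  have : PolishSpace Bool :=
    (IsClosedEmbedding.of_continuous_injective_isClosedMap (f := Bool.toNat)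
      continuous_of_discreteTopology (by decide)
      fun s _ => isClosed_discrete _).polishSpace
  infer_instance

/-- Perfect set theorem with a Borel map made continuous: this is the usual perfect set theorem for
a finer Polish topology. -/
theorem IsClosed.exists_cantor_injection_of_measurable {α β : Type*} [TopologicalSpace α]
    [PolishSpace α] [MeasurableSpace α] [BorelSpace α] [TopologicalSpace β] [MeasurableSpace β]
    [OpensMeasurableSpace β] [SecondCountableTopology β] {V : Set α} (hV : IsClosed V)
    (hunc : ¬ V.Countable) {r : α → β} (hr : Measurable r) :
    ∃ q : (ℕ → Bool) → α, range q ⊆ V ∧ Continuous q ∧ Function.Injective q ∧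
      Continuous (r ∘ q) := by
  have hex := hr.exists_continuous
  have ht := hex.choose_spec.1
  have hrc := hex.choose_spec.2.1
  obtain ⟨q, hqV, hqc, hqi⟩ := @IsClosed.exists_nat_bool_injection_of_not_countable _ hex.choose
    hex.choose_spec.2.2 V (hV.mono ht) hunc
  exact ⟨q, hqV, continuous_le_rng ht hqc, hqi, @Continuous.comp _ _ _ _ hex.choose _ _ _ hrc hqc⟩

/-- If `G c₀` increases from `0` to `r₀`, then there is a Cantor set in the part over a neighbourhood
of `c₀` of `2^ω × (0, 1]` on which `G` and the first projection are both injective. The second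
coordinate `r c = min {r | g c ≤ G (c, r)}`, for an injection `g` of `2^ω` into a short interval, is
only Borel, but it becomes continuous after a refinement of the topology of `2^ω`. -/
theorem exists_injective_selection_of_lt (G : C((ℕ → Bool) × unitInterval, ℝ)) (c₀ : ℕ → Bool)
    (r₀ : unitInterval) (h : G (c₀, 0) < G (c₀, r₀)) :
    ∃ (p : C(ℕ → Bool, ℕ → Bool)) (ρ : C(ℕ → Bool, unitInterval)), Function.Injective p ∧
      (∀ c, 0 < ρ c) ∧ Function.Injective fun c => G (p c, ρ c) := by
  obtain ⟨a, ha, h'⟩ := exists_between h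
  obtain ⟨b, hab, hb⟩ := exists_between h'
  obtain ⟨g, hgr, hgc, hgi⟩ := exists_cantor_injection_Icc hab
  have hga : ∀ c, a ≤ g c := fun c => (hgr ⟨c, rfl⟩).1
  have hgb : ∀ c, g c ≤ b := fun c => (hgr ⟨c, rfl⟩).2
  -- A closed condition that still gives the strict inequality `G (c, 0) < a`.
  let V : Set (ℕ → Bool) := {c | G (c, 0) ≤ (G (c₀, 0) + a) / 2 ∧ b ≤ G (c, r₀)}
  have hVcl : IsClosed V :=
    (isClosed_le (f := fun c => G (c, 0)) (by fun_prop) (by fun_prop)).inter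
      (isClosed_le (g := fun c => G (c, r₀)) (by fun_prop) (by fun_prop))
  have hVn : V ∈ 𝓝 c₀ := by
    have h1 : ∀ᶠ c in 𝓝 c₀, G (c, 0) < (G (c₀, 0) + a) / 2 :=
      ContinuousAt.eventually_lt (f := fun c => G (c, 0)) (by fun_prop) (by fun_prop)
        (by linarith)
    have h2 : ∀ᶠ c in 𝓝 c₀, b < G (c, r₀) :=
      ContinuousAt.eventually_lt (g := fun c => G (c, r₀)) (by fun_prop) (by fun_prop) hb
    filter_upwards [h1, h2] with c h1 h2 using ⟨h1.le, h2.le⟩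
  have hVa : ∀ c ∈ V, G (c, 0) < a := fun c hc => by
    have := hc.1
    linarith
  -- The point `1` is added so that the set is never empty; on `V` it changes nothing.
  let S : (ℕ → Bool) → Set unitInterval := fun c => {r | g c ≤ G (c, r) ∨ r = 1}
  have hSc : ∀ c, IsCompact (S c) := fun c =>
    ((isClosed_le (g := fun r => G (c, r)) (by fun_prop) (by fun_prop)).union isClosed_singleton).isCompact
  have hSl : ∀ c, ∃ r, IsLeast (S c) r := fun c =>
    (hSc c).exists_isLeast ⟨1, Or.inr rfl⟩
  choose r hr using hSl
  borelize (ℕ → Bool)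
  have hmeas : Measurable r := by
    refine measurable_of_Iic fun q => ?_
    have hcl : IsClosed {x : (ℕ → Bool) × unitInterval | (g x.1 ≤ G x ∨ x.2 = 1) ∧ x.2 ≤ q} :=
      ((isClosed_le (f := fun x : (ℕ → Bool) × unitInterval => g x.1) (g := G)
        (by fun_prop) (by fun_prop)).union
        (isClosed_eq (f := Prod.snd) continuous_snd continuous_const)).inter
        (isClosed_le (β := (ℕ → Bool) × unitInterval) (f := Prod.snd) (g := fun _ => q) continuous_snd
          continuous_const)
    have : r ⁻¹' Iic q =
        Prod.fst '' {x : (ℕ → Bool) × unitInterval | (g x.1 ≤ G x ∨ x.2 = 1) ∧ x.2 ≤ q} := by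
      ext c
      constructor
      · intro hc
        exact ⟨(c, r c), ⟨(hr c).1, hc⟩, rfl⟩
      · rintro ⟨⟨c', s⟩, ⟨hs, hsq⟩, rfl⟩
        exact ((hr c').2 hs).trans hsq
    rw [this]
    exact (isClosedMap_fst_of_compactSpace _ hcl).measurableSet
  have hGr : ∀ c ∈ V, g c ≤ G (c, r c) := by
    intro c hc
    rcases (hr c).1 with h1 | h1
    · exact h1
    · have h2 : r₀ ∈ S c := Or.inl ((hgb c).trans hc.2)
      have h3 : r c = r₀ := le_antisymm ((hr c).2 h2) (h1 ▸ unitInterval.le_one')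
      rw [h3]
      exact (hgb c).trans hc.2
  have hGeq : ∀ c ∈ V, G (c, r c) = g c := by
    intro c hc
    have hivt := intermediate_value_Icc (a := (0 : unitInterval)) (b := r c) unitInterval.nonneg'
      (f := fun s => G (c, s)) (by fun_prop)
    obtain ⟨s, hs, hs'⟩ := hivt ⟨((hVa c hc).le.trans (hga c)), hGr c hc⟩
    have h1 : r c ≤ s := (hr c).2 (Or.inl hs'.ge)
    rw [le_antisymm h1 hs.2]
    exact hs'
  have hrpos : ∀ c ∈ V, 0 < r c := by
    intro c hc
    refine unitInterval.pos_iff_ne_zero.2 fun h0 => ?_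
    have h1 := hGr c hc
    rw [h0] at h1
    exact absurd (hVa c hc) (not_lt.2 ((hga c).trans h1))
  obtain ⟨q, hqV, hqc, hqi, hrqc⟩ := hVcl.exists_cantor_injection_of_measurable
    (not_countable_of_mem_nhds_cantor hVn) hmeas
  have hqV' : ∀ c, q c ∈ V := fun c => hqV ⟨c, rfl⟩
  refine ⟨⟨q, hqc⟩, ⟨fun c => r (q c), hrqc⟩, hqi, fun c => hrpos _ (hqV' c), ?_⟩
  intro c c' hcc
  simp only [ContinuousMap.coe_mk, hGeq _ (hqV' _)] at hcc
  exact hqi (hgi hcc)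

theorem exists_injective_selection_of_ne (G : C((ℕ → Bool) × unitInterval, ℝ)) (c₀ : ℕ → Bool)
    (r₀ : unitInterval) (h : G (c₀, r₀) ≠ G (c₀, 0)) :
    ∃ (p : C(ℕ → Bool, ℕ → Bool)) (ρ : C(ℕ → Bool, unitInterval)), Function.Injective p ∧
      (∀ c, 0 < ρ c) ∧ Function.Injective fun c => G (p c, ρ c) := by
  rcases h.lt_or_gt with h | h
  · obtain ⟨p, ρ, hp, hρ, hi⟩ := exists_injective_selection_of_lt (-G) c₀ r₀ (by simpa using h)
    exact ⟨p, ρ, hp, hρ, fun c c' hcc => hi (by simpa using hcc)⟩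
  · exact exists_injective_selection_of_lt G c₀ r₀ h

/-! ### Systems of curves -/

/-- A choice, for each direction `θ` on the circle, of a Cantor set `c ↦ (base c, radius c)` in the
product of the Cantor space and the radius in direction `θ` of a punctured disk, rich enough that
each continuous real function that is not constant on all the disks is injective on uncountably
many of the chosen Cantor sets. The Boolean flag `true` is for the root of the tree, where the
Cantor space is to be thought of as collapsed to a point. -/
structure CurveSystem where
  /-- The position in the Cantor space. -/
  base : Bool → Circle → C(ℕ → Bool, ℕ → Bool)
  /-- The distance from the centre of the disk. -/
  radius : Bool → Circle → C(ℕ → Bool, unitInterval)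
  base_injective : ∀ b θ, Function.Injective (base b θ)
  radius_pos : ∀ b θ c, 0 < radius b θ c
  radius_injective : ∀ θ, Function.Injective (radius true θ)
  rich : ∀ (b : Bool) (F : C((ℕ → Bool) × Circle × unitInterval, ℝ)),
    (b = true → ∀ c c' x, F (c, x) = F (c', x)) → (∃ c θ r, F (c, θ, r) ≠ F (c, θ, 0)) →
    ¬ {θ | Function.Injective fun c => F (base b θ c, θ, radius b θ c)}.Countable

theorem nonempty_curveSystem : Nonempty CurveSystem := by
  let Y := C((ℕ → Bool) × Circle × unitInterval, ℝ)
  obtain ⟨lab, hlab⟩ := exists_uncountable_dense_fibers Y (mk_continuousMap_real_le _)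
  -- At the root the label is first made independent of the Cantor variable, so that
  -- injectivity along the curve forces injectivity of the radius.
  let τ : Bool → C((ℕ → Bool) × Circle × unitInterval, (ℕ → Bool) × Circle × unitInterval) :=
    fun b => if b then ⟨fun x => (fun _ => true, x.2), by fun_prop⟩ else ContinuousMap.id _
  have hex : ∀ (b : Bool) (θ : Circle),
      ∃ (p : C(ℕ → Bool, ℕ → Bool)) (ρ : C(ℕ → Bool, unitInterval)), Function.Injective p ∧
        (∀ c, 0 < ρ c) ∧ (b = true → Function.Injective ρ) ∧
        ((∃ c r, (lab θ).comp (τ b) (c, θ, r) ≠ (lab θ).comp (τ b) (c, θ, 0)) →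
          Function.Injective fun c => (lab θ).comp (τ b) (p c, θ, ρ c)) := by
    intro b θ
    by_cases hne : ∃ c r, (lab θ).comp (τ b) (c, θ, r) ≠ (lab θ).comp (τ b) (c, θ, 0)
    · obtain ⟨c₀, r₀, hne'⟩ := hne
      obtain ⟨p, ρ, hp, hρ, hi⟩ := exists_injective_selection_of_ne
        (((lab θ).comp (τ b)).comp ⟨fun x => (x.1, θ, x.2), by fun_prop⟩) c₀ r₀ hne'
      refine ⟨p, ρ, hp, hρ, ?_, fun _ => hi⟩
      rintro rfl c c' hcc
      refine hi ?_
      simp [τ, hcc]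
    · obtain ⟨g, hgr, hgc, hgi⟩ := exists_cantor_injection_Icc (a := 1 / 2) (b := 1) (by norm_num)
      have hg1 : ∀ c, 1 / 2 ≤ g c := fun c => (hgr ⟨c, rfl⟩).1
      have hg2 : ∀ c, g c ≤ 1 := fun c => (hgr ⟨c, rfl⟩).2
      refine ⟨ContinuousMap.id _, ⟨fun c => ⟨g c, by have := hg1 c; linarith, hg2 c⟩, by fun_prop⟩,
        fun _ _ h => h, fun c => ?_, fun _ c c' h => hgi (congrArg Subtype.val h),
        fun h => absurd h hne⟩
      rw [← Subtype.coe_lt_coe]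
      have := hg1 c
      exact lt_of_lt_of_le (by norm_num) this
  choose p ρ hp hρ hρi hi using hex
  refine ⟨⟨p, ρ, hp, hρ, fun θ => hρi true θ rfl, fun b F hF hne hcount => ?_⟩⟩
  obtain ⟨c₀, θ₀, r₀, h0⟩ := hne
  have hFτ : F.comp (τ b) = F := by
    ext x
    cases b
    · rfl
    · simp only [τ]
      exact hF rfl _ _ _
  have hopen : IsOpen {θ : Circle | F (c₀, θ, r₀) ≠ F (c₀, θ, 0)} :=
    isOpen_ne_fun (by fun_prop) (by fun_prop)
  refine hlab F _ hopen ⟨θ₀, h0⟩ (hcount.mono ?_)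
  rintro θ ⟨hθ, rfl⟩
  have := hi b θ
  rw [hFτ] at this
  exact this ⟨c₀, r₀, hθ⟩

/-! ### The Cantor sets of the tree -/

section Branch

variable {ι : Type*}

theorem treeVec_apply (s t : List ι) [Decidable (t = s)] :
    (treeVec s : TreeHilbert ι) t = if t = s then 1 else 0 := by
  classical
  rw [treeVec, lp.single_apply, Pi.single_apply]
  congr

theorem treeProj_apply (n : ℕ) (x : TreeHilbert ι) (s : List ι) :
    (treeProj n x) s = if s.length < n then x s else 0 := rfl

/-- Auxiliary version of `branch`, by recursion on the reversed sequence. -/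
noncomputable def branchRev (C : CurveSystem) (e : ι ≃ Circle) :
    List ι → (ℕ → Bool) → TreeHilbert ι
  | [], _ => 0
  | α :: l, c => branchRev C e l (C.base l.isEmpty (e α) c) +
      (((2⁻¹ : ℝ) ^ l.length * C.radius l.isEmpty (e α) c : ℝ) * (e α : ℂ) : ℂ) • treeVec l.reverse

/-- The parametrization by the Cantor space of the set `K_s`. The curve for `sα` lies over the
part `range (C.base _ (e α))` of the curve for `s`, on the radii of direction `e α` of the disks
attached there; at the root the curve degenerates to the constant `0`. -/
noncomputable def branch (C : CurveSystem) (e : ι ≃ Circle) (s : List ι) (c : ℕ → Bool) :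
    TreeHilbert ι :=
  branchRev C e s.reverse c

variable (C : CurveSystem) (e : ι ≃ Circle)

@[simp] theorem branch_nil (c : ℕ → Bool) : branch C e [] c = 0 := rfl

/-- The last coordinate of a point of the curve for `sα`. -/
noncomputable def tip (s : List ι) (α : ι) (c : ℕ → Bool) : ℂ :=
  ((2⁻¹ : ℝ) ^ s.length * C.radius s.isEmpty (e α) c : ℝ) * (e α : ℂ)

theorem branch_concat (s : List ι) (α : ι) (c : ℕ → Bool) :
    branch C e (s ++ [α]) c =
      branch C e s (C.base s.isEmpty (e α) c) + tip C e s α c • treeVec s := by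
  simp [branch, branchRev, tip]

theorem norm_tip (s : List ι) (α : ι) (c : ℕ → Bool) :
    ‖tip C e s α c‖ = (2⁻¹ : ℝ) ^ s.length * C.radius s.isEmpty (e α) c := by
  have h : 0 ≤ (2⁻¹ : ℝ) ^ s.length * C.radius s.isEmpty (e α) c :=
    mul_nonneg (by positivity) (C.radius _ _ _).2.1
  rw [tip, norm_mul, Circle.norm_coe, mul_one, Complex.norm_real, Real.norm_of_nonneg h]

theorem norm_tip_pos (s : List ι) (α : ι) (c : ℕ → Bool) : 0 < ‖tip C e s α c‖ := by
  rw [norm_tip]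
  exact mul_pos (by positivity) (C.radius_pos _ _ _)

theorem norm_tip_le (s : List ι) (α : ι) (c : ℕ → Bool) :
    ‖tip C e s α c‖ ≤ (2⁻¹ : ℝ) ^ s.length := by
  rw [norm_tip]
  exact mul_le_of_le_one_right (by positivity) (C.radius _ _ _).2.2

theorem branch_concat_apply (s : List ι) (α : ι) (c : ℕ → Bool) (t : List ι) [Decidable (t = s)] :
    branch C e (s ++ [α]) c t =
      branch C e s (C.base s.isEmpty (e α) c) t + if t = s then tip C e s α c else 0 := by
  rw [branch_concat, lp.coeFn_add, Pi.add_apply, lp.coeFn_smul, Pi.smul_apply, treeVec_apply]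
  simp

theorem branch_apply_ne_zero_iff (s : List ι) (c : ℕ → Bool) (t : List ι) :
    branch C e s c t ≠ 0 ↔ t <+: s ∧ t ≠ s := by
  classical
  induction s using List.reverseRecOn generalizing c with
  | nil => simp
  | append_singleton s α ih =>
    rw [branch_concat_apply]
    by_cases hts : t = s
    · subst hts
      have h0 : branch C e t (C.base t.isEmpty (e α) c) t = 0 := by
        by_contra h
        exact ((ih _).1 h).2 rfl
      have := norm_pos_iff.1 (norm_tip_pos C e t α c)
      simp [h0, this]
    · rw [if_neg hts, add_zero, ih, List.prefix_concat_iff]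
      constructor
      · rintro ⟨h, -⟩
        refine ⟨Or.inr h, ?_⟩
        rintro rfl
        simpa using h.length_le
      · rintro ⟨h | h, h'⟩
        · exact absurd h h'
        · exact ⟨h, hts⟩

theorem branch_apply_self (s : List ι) (c : ℕ → Bool) : branch C e s c s = 0 := by
  by_contra h
  exact ((branch_apply_ne_zero_iff C e s c s).1 h).2 rfl

theorem branch_concat_apply_self (s : List ι) (α : ι) (c : ℕ → Bool) :
    branch C e (s ++ [α]) c s = tip C e s α c := by
  classical
  rw [branch_concat_apply, branch_apply_self, if_pos rfl, zero_add]

theorem branch_apply_of_length_le {s t : List ι} (h : s.length ≤ t.length) (c : ℕ → Bool) :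
    branch C e s c t = 0 := by
  by_contra h0
  obtain ⟨h1, h2⟩ := (branch_apply_ne_zero_iff C e s c t).1 h0
  exact h2 (h1.eq_of_length (le_antisymm h1.length_le h))

theorem norm_branch_apply_le (s : List ι) (c : ℕ → Bool) (t : List ι) :
    ‖branch C e s c t‖ ≤ (2⁻¹ : ℝ) ^ t.length := by
  classical
  induction s using List.reverseRecOn generalizing c with
  | nil => simp
  | append_singleton s α ih =>
    by_cases hts : t = s
    · subst hts
      rw [branch_concat_apply_self]
      exact norm_tip_le C e t α c
    · rw [branch_concat_apply, if_neg hts, add_zero]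
      exact ih _

theorem treeProj_branch_self (s : List ι) (c : ℕ → Bool) :
    treeProj s.length (branch C e s c) = branch C e s c := by
  refine lp.ext (funext fun t => ?_)
  rw [treeProj_apply]
  split_ifs with h
  · rfl
  · exact (branch_apply_of_length_le C e (not_lt.1 h) c).symm

theorem treeProj_branch_concat (s : List ι) (α : ι) (c : ℕ → Bool) {n : ℕ} (hn : n ≤ s.length) :
    treeProj n (branch C e (s ++ [α]) c) =
      treeProj n (branch C e s (C.base s.isEmpty (e α) c)) := by
  classical
  refine lp.ext (funext fun t => ?_)
  rw [treeProj_apply, treeProj_apply]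
  split_ifs with h
  · rw [branch_concat_apply, if_neg, add_zero]
    rintro rfl
    omega
  · rfl

/-- The curve for `s` projects into the curve for each initial segment of `s`, and the
reparametrization is injective. -/
theorem exists_treeProj_branch {s t : List ι} (h : t <+: s) :
    ∃ q : (ℕ → Bool) → ℕ → Bool, Function.Injective q ∧
      ∀ c, treeProj t.length (branch C e s c) = branch C e t (q c) := by
  induction s using List.reverseRecOn with
  | nil =>
    obtain rfl : t = [] := by simpa using h
    exact ⟨id, Function.injective_id, fun c => treeProj_branch_self C e [] c⟩
  | append_singleton s α ih =>
    rcases List.prefix_concat_iff.1 h with rfl | h'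
    · exact ⟨id, Function.injective_id, fun c => treeProj_branch_self C e _ c⟩
    · obtain ⟨q, hq, hqc⟩ := ih h'
      refine ⟨fun c => q (C.base s.isEmpty (e α) c), hq.comp (C.base_injective _ _), fun c => ?_⟩
      rw [treeProj_branch_concat C e s α c h'.length_le, hqc]

theorem continuous_branch (s : List ι) : Continuous (branch C e s) := by
  induction s using List.reverseRecOn with
  | nil => exact continuous_const
  | append_singleton s α ih =>
    have h : branch C e (s ++ [α]) = fun c => branch C e s (C.base s.isEmpty (e α) c) +
        tip C e s α c • treeVec s := funext fun c => branch_concat C e s α c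
    rw [h]
    have ht : Continuous (tip C e s α) := by
      unfold tip
      fun_prop
    exact (ih.comp (C.base _ _).continuous).add (ht.smul continuous_const)

theorem branch_injective {s : List ι} (hs : s ≠ []) : Function.Injective (branch C e s) := by
  induction s using List.reverseRecOn with
  | nil => exact absurd rfl hs
  | append_singleton s α ih =>
    intro c c' h
    by_cases hs0 : s = []
    · subst hs0
      have h1 := congrArg (fun x : TreeHilbert ι => ‖x []‖) h
      have h2 := branch_concat_apply_self C e [] α
      simp only [h2, norm_tip] at h1
      simp only [List.length_nil, pow_zero, one_mul, List.isEmpty_nil] at h1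
      exact C.radius_injective (e α) (Subtype.ext h1)
    · have h1 := congrArg (treeProj s.length) h
      rw [treeProj_branch_concat C e s α c le_rfl, treeProj_branch_concat C e s α c' le_rfl,
        treeProj_branch_self, treeProj_branch_self] at h1
      exact C.base_injective _ _ (ih hs0 h1)

theorem tip_eq_imp {s : List ι} {α β : ι} {c c' : ℕ → Bool} (h : tip C e s α c = tip C e s β c') :
    α = β := by
  have hn : ‖tip C e s α c‖ = ‖tip C e s β c'‖ := by rw [h]
  have hpos := norm_tip_pos C e s α c
  rw [tip, tip, ← norm_tip, ← norm_tip, ← hn] at h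
  have h1 := mul_left_cancel₀ (Complex.ofReal_ne_zero.2 hpos.ne') h
  exact e.injective (Circle.ext h1)

theorem isCantorTree_range_branch : IsCantorTree fun s => range (branch C e s) where
  root := by
    ext x
    simp [eq_comm]
  cantor s α := by
    have h := (continuous_branch C e (s ++ [α])).isClosedEmbedding
      (branch_injective C e (by simp : s ++ [α] ≠ []))
    exact ⟨h.isEmbedding.toHomeomorph.symm⟩
  closed s α := (isCompact_range (continuous_branch C e _)).isClosed
  disjoint s α β hαβ := by
    rw [Set.disjoint_left]
    rintro _ ⟨c, rfl⟩ ⟨c', h⟩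
    refine hαβ (tip_eq_imp C e (s := s) (c := c) (c' := c') ?_)
    rw [← branch_concat_apply_self, ← branch_concat_apply_self, h]
  subset_disk s α := by
    rintro _ ⟨c, rfl⟩
    refine ⟨fun t _ => norm_branch_apply_le C e _ c t, fun t ht => ?_⟩
    by_contra h0
    obtain ⟨h1, h2⟩ := (branch_apply_ne_zero_iff C e _ c t).1 h0
    rcases List.prefix_concat_iff.1 h1 with h | h
    · exact h2 h
    · exact ht h
  coord_ne_zero s α := by
    rintro _ ⟨c, rfl⟩
    rw [branch_concat_apply_self]
    exact norm_pos_iff.1 (norm_tip_pos C e s α c)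
  proj_mem s α := by
    rintro _ ⟨c, rfl⟩
    rw [treeProj_branch_concat C e s α c le_rfl, treeProj_branch_self]
    exact mem_range_self _

end Branch

/-! ### The space `L_ω` in coordinates -/

section Coordinates

variable {ι : Type*}

/-- The restriction of a function on the tree to the sequences of length less than `n`. -/
def trunc (n : ℕ) (y : List ι → ℂ) : List ι → ℂ := fun s => if s.length < n then y s else 0

theorem continuous_trunc (n : ℕ) : Continuous (trunc n : (List ι → ℂ) → List ι → ℂ) := by
  refine continuous_pi fun s => ?_
  unfold trunc
  split_ifs
  · exact continuous_apply s
  · exact continuous_const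

theorem coe_treeProj (n : ℕ) (x : TreeHilbert ι) : ⇑(treeProj n x) = trunc n ⇑x := rfl

theorem trunc_trunc_of_le {m n : ℕ} (h : m ≤ n) (y : List ι → ℂ) :
    trunc m (trunc n y) = trunc m y := by
  funext s
  unfold trunc
  split_ifs <;> first | rfl | omega

theorem tendsto_trunc (y : List ι → ℂ) :
    Filter.Tendsto (fun n => trunc n y) Filter.atTop (𝓝 y) := by
  refine tendsto_pi_nhds.2 fun s => tendsto_const_nhds.congr' ?_
  filter_upwards [Filter.eventually_gt_atTop s.length] with n hn
  simp [trunc, hn]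

/-- The set of coordinate functions of the vectors in `L_ω`. -/
def coordLOmega (K : List ι → Set (TreeHilbert ι)) : Set (List ι → ℂ) :=
  {y | (∀ s, ‖y s‖ ≤ (2⁻¹ : ℝ) ^ s.length) ∧
    (∀ s t, ¬ s <+: t → ¬ t <+: s → y s = 0 ∨ y t = 0) ∧
    ∀ t, y t = 0 ∨ trunc t.length y ∈ (fun x : TreeHilbert ι => (⇑x : List ι → ℂ)) '' K t}

variable {K : List ι → Set (TreeHilbert ι)}

theorem mem_LOmega_iff {x : TreeHilbert ι} : x ∈ LOmega K ↔ ⇑x ∈ coordLOmega K := by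
  refine and_congr Iff.rfl (and_congr Iff.rfl (forall_congr' fun t => or_congr Iff.rfl ?_))
  constructor
  · exact fun h => ⟨_, h, rfl⟩
  · rintro ⟨y, hy, hyx⟩
    have : y = treeProj t.length x := lp.ext hyx
    exact this ▸ hy

theorem prefix_or_prefix_of_mem {y : List ι → ℂ} (hy : y ∈ coordLOmega K) {s t : List ι}
    (hs : y s ≠ 0) (ht : y t ≠ 0) : s <+: t ∨ t <+: s := by
  by_contra h
  push Not at h
  exact (hy.2.1 s t h.1 h.2).elim hs ht

theorem eq_of_length_eq_of_mem {y : List ι → ℂ} (hy : y ∈ coordLOmega K) {s t : List ι}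
    (hs : y s ≠ 0) (ht : y t ≠ 0) (h : s.length = t.length) : s = t :=
  (prefix_or_prefix_of_mem hy hs ht).elim (fun h' => h'.eq_of_length h)
    fun h' => (h'.eq_of_length h.symm).symm

/-- The support is a chain, so it has at most one element of each length. -/
theorem sum_norm_sq_le {y : List ι → ℂ} (hy : y ∈ coordLOmega K) (F : Finset (List ι)) :
    ∑ s ∈ F, ‖y s‖ ^ 2 ≤ 2 := by
  classical
  let F' := F.filter fun s => y s ≠ 0
  have h1 : ∑ s ∈ F, ‖y s‖ ^ 2 = ∑ s ∈ F', ‖y s‖ ^ 2 := by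
    refine (Finset.sum_filter_of_ne fun s _ h => ?_).symm
    rintro h0
    exact h (by simp [h0])
  have h2 : ∑ s ∈ F', ‖y s‖ ^ 2 ≤ ∑ s ∈ F', (1 / 2 : ℝ) ^ s.length := by
    refine Finset.sum_le_sum fun s _ => ?_
    have h3 := hy.1 s
    have h4 : (2⁻¹ : ℝ) ^ s.length ≤ 1 := pow_le_one₀ (by norm_num) (by norm_num)
    rw [one_div]
    nlinarith [norm_nonneg (y s)]
  have hinj : Set.InjOn List.length (F' : Set (List ι)) := fun s hs t ht h =>
    eq_of_length_eq_of_mem hy (Finset.mem_filter.1 hs).2 (Finset.mem_filter.1 ht).2 h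
  have h3 : ∑ s ∈ F', (1 / 2 : ℝ) ^ s.length = ∑ n ∈ F'.image List.length, (1 / 2 : ℝ) ^ n :=
    (Finset.sum_image hinj).symm
  rw [h1]
  refine h2.trans (h3.trans_le ?_)
  exact (summable_geometric_two.sum_le_tsum _ fun n _ => by positivity).trans_eq tsum_geometric_two

theorem memℓp_of_mem {y : List ι → ℂ} (hy : y ∈ coordLOmega K) : Memℓp y 2 :=
  memℓp_gen' (C := 2) fun F => by
    simpa [Real.rpow_two] using sum_norm_sq_le hy F

theorem norm_le_of_mem {x : TreeHilbert ι} (hx : ⇑x ∈ coordLOmega K) : ‖x‖ ≤ 2 := by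
  refine lp.norm_le_of_forall_sum_le (by norm_num) (by norm_num) fun F => ?_
  have := sum_norm_sq_le hx F
  simp only [ENNReal.toReal_ofNat, Real.rpow_two]
  linarith

/-- On bounded sets, coordinatewise continuity implies weak continuity. -/
theorem continuous_dual_comp {X κ : Type*} [TopologicalSpace X] {g : X → lp (fun _ : κ => ℂ) 2}
    {b : ℝ} (hb : ∀ x, ‖g x‖ ≤ b) (hg : ∀ s, Continuous fun x => g x s)
    (φ : StrongDual ℂ (lp (fun _ : κ => ℂ) 2)) : Continuous fun x => φ (g x) := by
  classical
  let w := (InnerProductSpace.toDual ℂ (lp (fun _ : κ => ℂ) 2)).symm φ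
  have hφ : ∀ v, φ v = inner ℂ w v := fun v =>
    (InnerProductSpace.toDual_symm_apply (y := φ) (x := v)).symm
  have hw : HasSum (fun s => lp.single 2 s (w s)) w := lp.hasSum_single (by norm_num) w
  have hu : TendstoUniformly (fun (F : Finset κ) x =>
      inner ℂ (∑ s ∈ F, lp.single 2 s (w s)) (g x)) (fun x => φ (g x)) Filter.atTop := by
    rw [Metric.tendstoUniformly_iff]
    intro ε hε
    have hb' : 0 < |b| + 1 := by positivity
    filter_upwards [Metric.tendsto_nhds.1 hw (ε / (|b| + 1)) (by positivity)] with F hF x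
    rw [dist_eq_norm, norm_sub_rev] at hF
    rw [hφ, dist_eq_norm, ← inner_sub_left]
    calc ‖inner ℂ (w - ∑ s ∈ F, lp.single 2 s (w s)) (g x)‖
        ≤ ‖w - ∑ s ∈ F, lp.single 2 s (w s)‖ * ‖g x‖ := norm_inner_le_norm _ _
      _ ≤ ‖w - ∑ s ∈ F, lp.single 2 s (w s)‖ * (|b| + 1) := by
        gcongr
        exact (hb x).trans ((le_abs_self b).trans (by linarith))
      _ < ε / (|b| + 1) * (|b| + 1) := by gcongr
      _ = ε := div_mul_cancel₀ _ hb'.ne'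
  refine hu.continuous (Filter.Frequently.of_forall fun F => ?_)
  simp only [sum_inner, lp.inner_single_left]
  refine continuous_finsetSum _ fun s _ => ?_
  exact continuous_const.inner (hg s)

theorem isClosed_coordLOmega (hK : ∀ s, IsCompact (K s)) : IsClosed (coordLOmega K) := by
  have hcoe : Continuous fun x : TreeHilbert ι => (⇑x : List ι → ℂ) :=
    continuous_pi fun s => (lp.evalCLM ℂ (fun _ : List ι => ℂ) 2 s).continuous
  simp only [coordLOmega, ofPred_and, ofPred_forall, ofPred_or]
  refine (isClosed_iInter fun s => isClosed_le (by fun_prop) (by fun_prop)).inter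
    ((isClosed_iInter fun s => isClosed_iInter fun t => isClosed_iInter fun _ =>
      isClosed_iInter fun _ => ?_).inter (isClosed_iInter fun t => ?_))
  · exact (isClosed_eq (by fun_prop) (by fun_prop)).union (isClosed_eq (by fun_prop) (by fun_prop))
  · exact (isClosed_eq (by fun_prop) (by fun_prop)).union
      (((hK t).image hcoe).isClosed.preimage (continuous_trunc _))

theorem isCompact_coordLOmega (hK : ∀ s, IsCompact (K s)) : IsCompact (coordLOmega K) :=
  (isCompact_univ_pi fun s : List ι =>
    isCompact_closedBall (0 : ℂ) ((2⁻¹ : ℝ) ^ s.length)).of_isClosed_subset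
    (isClosed_coordLOmega hK) fun y hy s _ => by simpa using hy.1 s

/-- The weak topology of `L_ω` is the topology of coordinatewise convergence. -/
theorem nonempty_homeomorph_coordLOmega (hK : ∀ s, IsCompact (K s)) :
    Nonempty (coordLOmega K ≃ₜ LOmegaWeak K) := by
  let E : coordLOmega K ≃ LOmegaWeak K :=
    { toFun := fun y => ⟨toWeakSpace ℂ (TreeHilbert ι) ⟨y.1, memℓp_of_mem y.2⟩,
        mem_image_of_mem _ (mem_LOmega_iff.2 y.2)⟩
      invFun := fun x => ⟨⇑((toWeakSpace ℂ (TreeHilbert ι)).symm x.1), by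
        obtain ⟨_, v, hv, rfl⟩ := x
        exact mem_LOmega_iff.1 hv⟩
      left_inv := fun y => rfl
      right_inv := fun x => rfl }
  have hE : Continuous E := by
    refine Continuous.subtype_mk (WeakBilin.continuous_of_continuous_eval _ fun φ => ?_) _
    exact continuous_dual_comp (g := fun y : coordLOmega K =>
      (⟨y.1, memℓp_of_mem y.2⟩ : TreeHilbert ι)) (fun y => norm_le_of_mem y.2)
      (fun s => (continuous_apply s).comp continuous_subtype_val) φ
  have := isCompact_iff_compactSpace.1 (isCompact_coordLOmega hK)
  exact ⟨hE.homeoOfEquivCompactToT2⟩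

end Coordinates

/-! ### First countability -/

section FirstCountable

variable {ι : Type*} {K : List ι → Set (TreeHilbert ι)}

theorem trunc_mem_coordLOmega {y : List ι → ℂ} (hy : y ∈ coordLOmega K)
    (n : ℕ) : trunc n y ∈ coordLOmega K := by
  have h : ∀ s, trunc n y s = 0 ∨ s.length < n ∧ trunc n y s = y s := fun s => by
    by_cases hs : s.length < n <;> simp [trunc, hs]
  refine ⟨fun s => ?_, fun s t hst hts => ?_, fun t => ?_⟩
  · rcases h s with h | h
    · rw [h, norm_zero]
      positivity
    · rw [h.2]
      exact hy.1 s
  · rcases h s with h1 | h1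
    · exact Or.inl h1
    rcases h t with h2 | h2
    · exact Or.inr h2
    rw [h1.2, h2.2]
    exact hy.2.1 s t hst hts
  · rcases h t with h | h
    · exact Or.inl h
    · rw [h.2, trunc_trunc_of_le h.1.le]
      exact hy.2.2 t

/-- There is at most one `u` of each length `n` with `π_n(y) ∈ K_u`: the last coordinate of the elements of `K_{sα}` is not zero, which
determines `s`, and then disjointness determines `α`. -/
theorem eq_of_trunc_mem (hK : IsCantorTree K) {y : List ι → ℂ} (hy : y ∈ coordLOmega K)
    {u v : List ι} (hu : trunc u.length y ∈ (fun x : TreeHilbert ι => (⇑x : List ι → ℂ)) '' K u)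
    (hv : trunc v.length y ∈ (fun x : TreeHilbert ι => (⇑x : List ι → ℂ)) '' K v)
    (h : u.length = v.length) : u = v := by
  rcases List.eq_nil_or_concat' u with rfl | ⟨s, α, rfl⟩
  · exact (List.length_eq_zero_iff.1 h.symm).symm
  rcases List.eq_nil_or_concat' v with rfl | ⟨t, β, rfl⟩
  · simp at h
  rw [← h] at hv
  simp only [List.length_append, List.length_singleton, Nat.add_right_cancel_iff] at h hu hv
  obtain ⟨a, ha, hay⟩ := hu
  obtain ⟨b, hb, hby⟩ := hv
  have hab : a = b := lp.ext (hay.trans hby.symm)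
  subst hab
  have hs : y s ≠ 0 := by
    have := hK.coord_ne_zero s α a ha
    rw [show (a : List ι → ℂ) = _ from hay] at this
    simpa [trunc] using this
  have ht : y t ≠ 0 := by
    have := hK.coord_ne_zero t β a hb
    rw [show (a : List ι → ℂ) = _ from hay] at this
    simpa [trunc, h] using this
  obtain rfl := eq_of_length_eq_of_mem hy hs ht h
  by_cases hαβ : α = β
  · rw [hαβ]
  · exact absurd hb (Set.disjoint_left.1 (hK.disjoint s α β hαβ) ha)

/-- The coordinates at the `u` with `π_{lh(u)}(y) ∈ K_u` determine `y` in `L_ω`: if the coordinates of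
`x` and `y` agree at all shorter sequences, then outside this set both coordinates at `u` are zero. -/
theorem exists_countable_determining (hK : IsCantorTree K) {y : List ι → ℂ}
    (hy : y ∈ coordLOmega K) :
    ∃ S : Set (List ι), S.Countable ∧ ∀ x ∈ coordLOmega K, (∀ s ∈ S, x s = y s) → x = y := by
  let S : Set (List ι) :=
    {u | trunc u.length y ∈ (fun x : TreeHilbert ι => (⇑x : List ι → ℂ)) '' K u}
  have hS : S.InjOn List.length := fun u hu v hv h => eq_of_trunc_mem hK hy hu hv h
  refine ⟨S, countable_of_injective_of_countable_image hS (to_countable _), fun x hx hxy => ?_⟩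
  have key : ∀ n, trunc n x = trunc n y := by
    intro n
    induction n with
    | zero => funext s; simp [trunc]
    | succ n ih =>
      funext s
      rcases lt_trichotomy s.length n with hs | hs | hs
      · have := congrFun ih s
        simp only [trunc, if_pos hs] at this
        simp [trunc, hs.trans (Nat.lt_succ_self n), this]
      · subst hs
        simp only [trunc, Nat.lt_succ_self, if_true]
        by_cases hsS : s ∈ S
        · exact hxy s hsS
        · rw [(hy.2.2 s).resolve_right hsS, (hx.2.2 s).resolve_right (by rw [ih]; exact hsS)]
      · simp [trunc, not_lt.2 (Nat.succ_le_of_lt hs)]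
  exact tendsto_nhds_unique (tendsto_trunc x)
    ((funext key : (fun n => trunc n x) = _) ▸ tendsto_trunc y)

theorem firstCountable_coordLOmega (hK : IsCantorTree K) (hc : ∀ s, IsCompact (K s)) :
    FirstCountableTopology (coordLOmega K) := by
  have := isCompact_iff_compactSpace.1 (isCompact_coordLOmega hc)
  refine ⟨fun y => ?_⟩
  obtain ⟨S, hS, hdet⟩ := exists_countable_determining hK y.2
  have := hS.to_subtype
  let ρ : coordLOmega K → S → ℂ := fun x s => x.1 s
  have hρ : Continuous ρ := continuous_pi fun s => (continuous_apply s.1).comp continuous_subtype_val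
  have hfib : ρ ⁻¹' {ρ y} = {y} := by
    ext x
    refine ⟨fun h => Subtype.ext (hdet x x.2 fun s hs => congrFun h ⟨s, hs⟩), ?_⟩
    rintro rfl
    rfl
  have hn : Filter.comap ρ (𝓝 (ρ y)) = 𝓝 y := by
    rw [hρ.isClosedMap.comap_nhds_eq hρ, hfib, nhdsSet_singleton]
  rw [← hn]
  infer_instance

end FirstCountable

/-! ### Locally constant functions -/

section LocallyConstant

theorem EZero_comp_homeomorph {X Y M : Type*} [TopologicalSpace X] [TopologicalSpace Y]
    [TopologicalSpace M] (h : X ≃ₜ Y) {f : C(Y, M)} (hf : f ∈ EZero Y M) :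
    f.comp (h : C(X, Y)) ∈ EZero X M := by
  have hsub : h ⁻¹' constancySet f ⊆ constancySet (f.comp (h : C(X, Y))) := by
    rintro x ⟨U, ⟨hU, hc⟩, hx⟩
    exact ⟨h ⁻¹' U, ⟨hU.preimage h.continuous, fun a ha b hb => hc _ ha _ hb⟩, hx⟩
  exact (hf.preimage h.isOpenMap).mono hsub

theorem EZero_postcomp {X M N : Type*} [TopologicalSpace X] [TopologicalSpace M]
    [TopologicalSpace N] (g : C(M, N)) {f : C(X, M)} (hf : f ∈ EZero X M) :
    g.comp f ∈ EZero X N :=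
  Dense.mono (by
    rintro x ⟨U, ⟨hU, hc⟩, hx⟩
    exact ⟨U, ⟨hU, fun a ha b hb => congrArg g (hc a ha b hb)⟩, hx⟩) hf

theorem EZero_codRestrict_range {X M : Type*} [TopologicalSpace X] [TopologicalSpace M]
    {f : C(X, M)} (hf : f ∈ EZero X M) :
    (⟨rangeFactorization f, f.continuous.subtype_mk _⟩ : C(X, range f)) ∈ EZero X (range f) :=
  Dense.mono (by
    rintro x ⟨U, ⟨hU, hc⟩, hx⟩
    exact ⟨U, ⟨hU, fun a ha b hb => Subtype.ext (hc a ha b hb)⟩, hx⟩) hf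

/-- On a compact space, it suffices to consider real functions. -/
theorem eq_of_mem_EZero_of_real {X M : Type*} [TopologicalSpace X] [CompactSpace X]
    [TopologicalSpace M] [T2Space M] (h : ∀ f ∈ EZero X ℝ, ∀ x y, f x = f y)
    {f : C(X, M)} (hf : f ∈ EZero X M) (x y : X) : f x = f y := by
  by_contra hne
  have : CompactSpace (range f) := isCompact_iff_compactSpace.1 (isCompact_range f.continuous)
  let f' : C(X, range f) := ⟨rangeFactorization f, f.continuous.subtype_mk _⟩
  have hne' : f' x ≠ f' y := fun h' => hne (congrArg Subtype.val h')
  obtain ⟨g, hg0, hg1, -⟩ := exists_continuous_zero_one_of_isClosed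
    (isClosed_singleton (x := f' x)) (isClosed_singleton (x := f' y))
    (Set.disjoint_singleton.2 hne')
  have h1 := h (g.comp f') (EZero_postcomp g (EZero_codRestrict_range hf)) x y
  simp only [ContinuousMap.comp_apply] at h1
  rw [hg0 rfl, hg1 rfl] at h1
  simp at h1

variable {ι : Type*} {K : List ι → Set (TreeHilbert ι)}

theorem coord_ne_zero_of_prefix (hK : IsCantorTree K) {y : List ι → ℂ} (hy : y ∈ coordLOmega K)
    {s t : List ι} (hst : s <+: t) (ht : y t ≠ 0) : y s ≠ 0 := by
  induction t using List.reverseRecOn with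
  | nil =>
    obtain rfl : s = [] := by simpa using hst
    exact ht
  | append_singleton t α ih =>
    rcases List.prefix_concat_iff.1 hst with rfl | h
    · exact ht
    · refine ih h ?_
      obtain ⟨a, ha, hay⟩ := (hy.2.2 _).resolve_left ht
      have := hK.coord_ne_zero t α a ha
      rw [show (a : List ι → ℂ) = _ from hay] at this
      simpa [trunc] using this

theorem trunc_succ_of_ne_zero {y : List ι → ℂ} (hy : y ∈ coordLOmega K) {s : List ι}
    (hs : y s ≠ 0) [DecidableEq (List ι)] :
    trunc (s.length + 1) y = trunc s.length y + Pi.single s (y s) := by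
  funext t
  rw [Pi.add_apply, Pi.single_apply]
  by_cases hts : t = s
  · subst hts
    simp [trunc]
  · rw [if_neg hts, add_zero]
    rcases lt_trichotomy t.length s.length with h | h | h
    · simp [trunc, h, h.trans (Nat.lt_succ_self _)]
    · have h0 : y t = 0 := by
        by_contra h0
        exact hts (eq_of_length_eq_of_mem hy h0 hs h)
      simp [trunc, h0]
    · simp [trunc, not_lt.2 (Nat.succ_le_of_lt h), h.not_gt]

theorem trunc_succ_of_eq_zero {y : List ι → ℂ} {n : ℕ} (h : ∀ s : List ι, s.length = n → y s = 0) :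
    trunc (n + 1) y = trunc n y := by
  funext t
  rcases lt_trichotomy t.length n with h' | h' | h'
  · simp [trunc, h', h'.trans (Nat.lt_succ_self _)]
  · simp [trunc, h t h']
  · simp [trunc, not_lt.2 (Nat.succ_le_of_lt h'), h'.not_gt]

/-- A truncation that is not zero can be taken to end at a nonzero coordinate. -/
theorem trunc_eq_zero_or (y : List ι → ℂ) (m : ℕ) :
    trunc m y = 0 ∨ ∃ t : List ι, y t ≠ 0 ∧ trunc m y = trunc (t.length + 1) y := by
  induction m with
  | zero => exact Or.inl (funext fun s => by simp [trunc])
  | succ m ih =>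
    by_cases h : ∃ s : List ι, s.length = m ∧ y s ≠ 0
    · obtain ⟨s, rfl, hs⟩ := h
      exact Or.inr ⟨s, hs, rfl⟩
    · push Not at h
      rw [trunc_succ_of_eq_zero h]
      exact ih

/-- The projection `π_n` as a self-map of `L_ω`. -/
def truncL (n : ℕ) (y : coordLOmega K) : coordLOmega K :=
  ⟨trunc n y.1, trunc_mem_coordLOmega y.2 n⟩

theorem continuous_truncL (n : ℕ) : Continuous (truncL n : coordLOmega K → coordLOmega K) :=
  ((continuous_trunc n).comp continuous_subtype_val).subtype_mk _

/-- A continuous real function forgets the coordinates from `u` on, for all but countably many of the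
sequences `u` of a given length: the open sets `{x | x u ≠ 0}` are pairwise disjoint, and finitely
many of them cover the compact set `{x | ε ≤ |f x - f (π_n x)|}`. -/
theorem countable_setOf_ne_trunc (hK : IsCantorTree K) (hc : ∀ s, IsCompact (K s))
    (f : C(coordLOmega K, ℝ)) (n : ℕ) :
    {u : List ι | u.length = n ∧
      ∃ x : coordLOmega K, x.1 u ≠ 0 ∧ f x ≠ f (truncL n x)}.Countable := by
  have := isCompact_iff_compactSpace.1 (isCompact_coordLOmega hc)
  have hcont := continuous_truncL (K := K) n
  let A : ℕ → Set (List ι) := fun k => {u : List ι | u.length = n ∧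
    ∃ x : coordLOmega K, x.1 u ≠ 0 ∧ 1 / ((k : ℝ) + 1) ≤ |f x - f (truncL n x)|}
  have hA : ∀ k, (A k).Finite := by
    intro k
    have hk : (0 : ℝ) < 1 / ((k : ℝ) + 1) := by positivity
    let Z : Set (coordLOmega K) := {x | 1 / ((k : ℝ) + 1) ≤ |f x - f (truncL n x)|}
    have hZ : IsCompact Z := (isClosed_le (by fun_prop) (by fun_prop)).isCompact
    let O : {u : List ι // u.length = n} → Set (coordLOmega K) := fun u => {x | x.1 u.1 ≠ 0}
    have hO : ∀ u, IsOpen (O u) := fun u =>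
      isOpen_ne_fun ((continuous_apply u.1).comp continuous_subtype_val) continuous_const
    have hcov : Z ⊆ ⋃ u, O u := by
      intro x hx
      have hne : x.1 ≠ trunc n x.1 := by
        intro h
        have h' : truncL n x = x := Subtype.ext h.symm
        have hx' : 1 / ((k : ℝ) + 1) ≤ |f x - f (truncL n x)| := hx
        rw [h', sub_self, abs_zero] at hx'
        exact absurd hx' (not_le.2 hk)
      obtain ⟨t, ht⟩ := Function.ne_iff.1 hne
      have htn : n ≤ t.length := by
        by_contra h
        exact ht (by simp [trunc, not_le.1 h])
      have ht0 : x.1 t ≠ 0 := by simpa [trunc, not_lt.2 htn] using ht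
      exact mem_iUnion.2 ⟨⟨t.take n, by simp [htn]⟩,
        coord_ne_zero_of_prefix hK x.2 (List.take_prefix n t) ht0⟩
    obtain ⟨F, hF⟩ := hZ.elim_finite_subcover O hO hcov
    refine (F.finite_toSet.image Subtype.val).subset ?_
    rintro u ⟨hu, x, hxu, hx⟩
    obtain ⟨v, hv, hxv⟩ := mem_iUnion₂.1 (hF hx)
    exact ⟨v, hv, eq_of_length_eq_of_mem x.2 hxv hxu (v.2.trans hu.symm)⟩
  refine (countable_iUnion fun k => (hA k).countable).mono ?_
  rintro u ⟨hu, x, hxu, hx⟩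
  obtain ⟨k, hk⟩ := exists_nat_one_div_lt (abs_pos.2 (sub_ne_zero.2 hx))
  exact mem_iUnion.2 ⟨k, hu, x, hxu, hk.le⟩

end LocallyConstant

/-! ### Functions on the space built from the curves -/

section Main

variable {ι : Type*} (C : CurveSystem) (e : ι ≃ Circle)

/-- The Cantor tree of the curves `branch C e s`. -/
def branchSet (s : List ι) : Set (TreeHilbert ι) := range (branch C e s)

theorem isCompact_branchSet (s : List ι) : IsCompact (branchSet C e s) :=
  isCompact_range (continuous_branch C e s)

/-- The disks attached at the points of `K_s` are contained in `L_ω`. -/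
theorem branch_add_smul_mem_LOmega (s : List ι) (c : ℕ → Bool) {z : ℂ}
    (hz : ‖z‖ ≤ (2⁻¹ : ℝ) ^ s.length) :
    branch C e s c + z • treeVec s ∈ LOmega (branchSet C e) := by
  classical
  have hval : ∀ t, (branch C e s c + z • treeVec s) t =
      branch C e s c t + if t = s then z else 0 := fun t => by
    rw [lp.coeFn_add, Pi.add_apply, lp.coeFn_smul, Pi.smul_apply, treeVec_apply]
    simp
  have hsupp : ∀ t, ¬ t <+: s → (branch C e s c + z • treeVec s) t = 0 := by
    intro t ht
    have h1 : t ≠ s := by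
      rintro rfl
      exact ht List.prefix_rfl
    rw [hval, if_neg h1, add_zero]
    by_contra h0
    exact ht ((branch_apply_ne_zero_iff C e s c t).1 h0).1
  refine ⟨fun t => ?_, fun t t' h1 h2 => ?_, fun t => ?_⟩
  · rw [hval]
    split_ifs with h
    · subst h
      rwa [branch_apply_self, zero_add]
    · rw [add_zero]
      exact norm_branch_apply_le C e s c t
  · by_contra h
    push Not at h
    have ht : t <+: s := by
      by_contra h'
      exact h.1 (hsupp t h')
    have ht' : t' <+: s := by
      by_contra h'
      exact h.2 (hsupp t' h')
    rcases List.prefix_or_prefix_of_prefix ht ht' with h' | h'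
    · exact h1 h'
    · exact h2 h'
  · by_cases ht : t <+: s
    · right
      obtain ⟨q, -, hq⟩ := exists_treeProj_branch C e ht
      refine ⟨q c, ?_⟩
      rw [← hq c]
      refine lp.ext (funext fun u => ?_)
      rw [treeProj_apply, treeProj_apply, hval]
      split_ifs with h1 h2
      · subst h2
        exact absurd ht.length_le (not_le.2 h1)
      · rw [add_zero]
      · rfl
    · exact Or.inl (hsupp t ht)

/-- The point `branch C e s c + z e_s` of `L_ω`, in coordinates. -/
noncomputable def diskPoint (s : List ι) (c : ℕ → Bool) (z : ℂ) (hz : ‖z‖ ≤ (2⁻¹ : ℝ) ^ s.length) :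
    coordLOmega (branchSet C e) :=
  ⟨_, mem_LOmega_iff.1 (branch_add_smul_mem_LOmega C e s c hz)⟩

theorem coe_diskPoint [DecidableEq (List ι)] (s : List ι) (c : ℕ → Bool) (z : ℂ)
    (hz : ‖z‖ ≤ (2⁻¹ : ℝ) ^ s.length) :
    (diskPoint C e s c z hz).1 = ⇑(branch C e s c) + Pi.single s z := by
  funext t
  simp only [diskPoint]
  rw [lp.coeFn_add, Pi.add_apply, Pi.add_apply, lp.coeFn_smul, Pi.smul_apply, treeVec_apply,
    Pi.single_apply]
  simp

theorem continuous_diskPoint {X : Type*} [TopologicalSpace X] (s : List ι) {c : X → ℕ → Bool}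
    {z : X → ℂ} (hc : Continuous c) (hz : Continuous z)
    (hzs : ∀ x, ‖z x‖ ≤ (2⁻¹ : ℝ) ^ s.length) :
    Continuous fun x => diskPoint C e s (c x) (z x) (hzs x) := by
  refine Continuous.subtype_mk (continuous_pi fun t => ?_) _
  refine (lp.evalCLM ℂ (fun _ : List ι => ℂ) 2 t).continuous.comp
    (f := fun x => branch C e s (c x) + z x • treeVec s) ?_
  exact ((continuous_branch C e s).comp hc).add (hz.smul continuous_const)

theorem diskPoint_apply_ne_zero {s u : List ι} (hu : u <+: s) (c : ℕ → Bool) {z : ℂ}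
    (hz : ‖z‖ ≤ (2⁻¹ : ℝ) ^ s.length) (hz0 : z ≠ 0) : (diskPoint C e s c z hz).1 u ≠ 0 := by
  classical
  rw [coe_diskPoint, Pi.add_apply, Pi.single_apply]
  split_ifs with h
  · subst h
    rwa [branch_apply_self, zero_add]
  · rw [add_zero, branch_apply_ne_zero_iff]
    exact ⟨hu, h⟩

theorem prefix_of_diskPoint_apply_ne_zero {s u : List ι} {c : ℕ → Bool} {z : ℂ}
    {hz : ‖z‖ ≤ (2⁻¹ : ℝ) ^ s.length} (h : (diskPoint C e s c z hz).1 u ≠ 0) : u <+: s := by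
  classical
  rw [coe_diskPoint, Pi.add_apply, Pi.single_apply] at h
  split_ifs at h with hus
  · exact hus ▸ List.prefix_rfl
  · rw [add_zero, branch_apply_ne_zero_iff] at h
    exact h.1

/-- If the coordinate of `y` at `t` is not zero, then the projections of `y` with and without that
coordinate lie on one disk at `t`, the latter at its centre. -/
theorem exists_truncL_eq_diskPoint (y : coordLOmega (branchSet C e)) {t : List ι}
    (ht : y.1 t ≠ 0) :
    ∃ c, truncL (t.length + 1) y = diskPoint C e t c (y.1 t) (y.2.1 t) ∧
      truncL t.length y = diskPoint C e t c 0 (by simp) := by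
  classical
  obtain ⟨_, ⟨c, rfl⟩, hc⟩ := (y.2.2.2 t).resolve_left ht
  have hc' : ⇑(branch C e t c) = trunc t.length y.1 := hc
  refine ⟨c, Subtype.ext ?_, Subtype.ext ?_⟩
  · rw [coe_diskPoint, hc']
    exact trunc_succ_of_ne_zero y.2 ht
  · rw [coe_diskPoint, hc', Pi.single_zero, add_zero]
    rfl

theorem exists_truncL_diskPoint {s u : List ι} (hu : u <+: s) (z : ℂ)
    (hz : ‖z‖ ≤ (2⁻¹ : ℝ) ^ s.length) :
    ∃ q : (ℕ → Bool) → ℕ → Bool, Function.Injective q ∧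
      ∀ c, truncL u.length (diskPoint C e s c z hz) = diskPoint C e u (q c) 0 (by simp) := by
  classical
  obtain ⟨q, hq, hqc⟩ := exists_treeProj_branch C e hu
  refine ⟨q, hq, fun c => Subtype.ext ?_⟩
  rw [coe_diskPoint, ← hqc, Pi.single_zero, add_zero, coe_treeProj]
  change trunc u.length (diskPoint C e s c z hz).1 = _
  rw [coe_diskPoint]
  funext t
  unfold trunc
  split_ifs with h
  · rw [Pi.add_apply, Pi.single_apply, if_neg, add_zero]
    rintro rfl
    exact absurd hu.length_le (not_le.2 h)
  · rfl

/-- The points of the curve for `sα` as points of disks at `s`, and as centres of disks at `sα`. -/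
theorem diskPoint_tip (s : List ι) (α : ι) (c : ℕ → Bool) :
    diskPoint C e s (C.base s.isEmpty (e α) c) (tip C e s α c) (norm_tip_le C e s α c) =
      diskPoint C e (s ++ [α]) c 0 (by simp) := by
  refine Subtype.ext ?_
  simp only [diskPoint, zero_smul, add_zero, branch_concat]

/-- A continuous function that is constant on each of the attached disks is constant. -/
theorem eq_of_forall_disk (f : C(coordLOmega (branchSet C e), ℝ))
    (h : ∀ s c z hz, f (diskPoint C e s c z hz) = f (diskPoint C e s c 0 (by simp)))
    (x y : coordLOmega (branchSet C e)) : f x = f y := by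
  have hstep : ∀ (x : coordLOmega (branchSet C e)) n, f (truncL n x) = f (truncL 0 x) := by
    intro x n
    induction n with
    | zero => rfl
    | succ n ih =>
      rw [← ih]
      by_cases hs : ∃ s : List ι, s.length = n ∧ x.1 s ≠ 0
      · obtain ⟨s, rfl, hs⟩ := hs
        obtain ⟨c, h1, h2⟩ := exists_truncL_eq_diskPoint C e x hs
        rw [h1, h2, h]
      · push Not at hs
        exact congrArg f (Subtype.ext (trunc_succ_of_eq_zero hs))
  have hlim : ∀ x : coordLOmega (branchSet C e), f x = f (truncL 0 x) := by
    intro x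
    have h1 : Filter.Tendsto (fun n => f (truncL n x)) Filter.atTop (𝓝 (f x)) :=
      (f.continuous.tendsto x).comp (tendsto_subtype_rng.2 (tendsto_trunc x.1))
    simp only [hstep] at h1
    exact tendsto_nhds_unique h1 tendsto_const_nhds
  rw [hlim x, hlim y]
  exact congrArg f (Subtype.ext (funext fun s => by simp [truncL, trunc]))

/-- If `f` is not constant on a disk at `s`, then there is `u = sα` such that `f` is injective
on `K_u` and forgets the coordinates from `u` on. -/
theorem exists_injective_branch_of_ne (f : C(coordLOmega (branchSet C e), ℝ)) (s : List ι)
    (c : ℕ → Bool) (z : ℂ) (hz : ‖z‖ ≤ (2⁻¹ : ℝ) ^ s.length)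
    (hne : f (diskPoint C e s c z hz) ≠ f (diskPoint C e s c 0 (by simp))) :
    ∃ u, (Function.Injective fun c => f (diskPoint C e u c 0 (by simp))) ∧
      ∀ x : coordLOmega (branchSet C e), x.1 u ≠ 0 → f x = f (truncL u.length x) := by
  have hbound : ∀ (θ : Circle) (r : unitInterval),
      ‖(((2⁻¹ : ℝ) ^ s.length * r : ℝ) * (θ : ℂ) : ℂ)‖ ≤ (2⁻¹ : ℝ) ^ s.length := by
    intro θ r
    rw [norm_mul, Circle.norm_coe, mul_one, Complex.norm_real,
      Real.norm_of_nonneg (mul_nonneg (by positivity) r.2.1)]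
    exact mul_le_of_le_one_right (by positivity) r.2.2
  let F : C((ℕ → Bool) × Circle × unitInterval, ℝ) :=
    ⟨fun x => f (diskPoint C e s x.1 (((2⁻¹ : ℝ) ^ s.length * x.2.2 : ℝ) * (x.2.1 : ℂ) : ℂ)
      (hbound x.2.1 x.2.2)), f.continuous.comp
        (continuous_diskPoint C e s (by fun_prop) (by fun_prop) fun _ => hbound _ _)⟩
  have hroot : s.isEmpty = true → ∀ c c' x, F (c, x) = F (c', x) := by
    intro hs c c' x
    rw [List.isEmpty_iff] at hs
    subst hs
    exact congrArg f (Subtype.ext (by simp only [diskPoint, branch_nil]))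
  have hFne : ∃ c θ r, F (c, θ, r) ≠ F (c, θ, 0) := by
    have hpow : (0 : ℝ) < 2⁻¹ ^ s.length := by positivity
    refine ⟨c, Circle.exp z.arg, ⟨‖z‖ / 2⁻¹ ^ s.length, by positivity, (div_le_one hpow).2 hz⟩, ?_⟩
    have h1 : (((2⁻¹ : ℝ) ^ s.length * (‖z‖ / 2⁻¹ ^ s.length) : ℝ) * (Circle.exp z.arg : ℂ) : ℂ)
        = z := by
      rw [mul_div_cancel₀ _ hpow.ne', Circle.coe_exp, Complex.norm_mul_exp_arg_mul_I]
    have h0 : (((2⁻¹ : ℝ) ^ s.length * ((0 : unitInterval) : ℝ) : ℝ) *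
        (Circle.exp z.arg : ℂ) : ℂ) = 0 := by
      simp
    simp only [F, ContinuousMap.coe_mk, h1, h0]
    exact hne
  have hrich := C.rich s.isEmpty F hroot hFne
  have hcount := countable_setOf_ne_trunc (K := branchSet C e) (isCantorTree_range_branch C e)
    (isCompact_branchSet C e) f (s.length + 1)
  have hcount' := hcount.preimage_of_injOn (f := fun θ => s ++ [e.symm θ])
    fun θ _ θ' _ h => by simpa using h
  obtain ⟨θ, hθ, hθ'⟩ : ∃ θ, θ ∈ {θ | Function.Injective fun c =>
      F (C.base s.isEmpty θ c, θ, C.radius s.isEmpty θ c)} ∧ θ ∉ _ := by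
    by_contra h
    push Not at h
    exact hrich (hcount'.mono h)
  obtain ⟨α, rfl⟩ := e.surjective θ
  refine ⟨s ++ [α], ?_, fun x hx => ?_⟩
  · simp only [← diskPoint_tip]
    exact hθ
  · by_contra hfx
    refine hθ' ⟨by simp, x, by simpa using hx, ?_⟩
    simpa using hfx

/-- If `f` were not constant, it would be injective on some `K_u` and depend on the projection to
`K_u` only where the coordinate at `u` is not zero; but no nonempty open set there projects to one
point. -/
theorem eq_of_mem_EZero {f : C(coordLOmega (branchSet C e), ℝ)}
    (hf : f ∈ EZero (coordLOmega (branchSet C e)) ℝ) (x y : coordLOmega (branchSet C e)) :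
    f x = f y := by
  refine eq_of_forall_disk C e f (fun s c z hz => ?_) x y
  by_contra hne
  obtain ⟨u, hinj, hforget⟩ := exists_injective_branch_of_ne C e f s c z hz hne
  have hO : IsOpen {x : coordLOmega (branchSet C e) | x.1 u ≠ 0} :=
    isOpen_ne_fun ((continuous_apply u).comp continuous_subtype_val) continuous_const
  have hOne : {x : coordLOmega (branchSet C e) | x.1 u ≠ 0}.Nonempty :=
    ⟨diskPoint C e u c ((2⁻¹ : ℝ) ^ u.length : ℝ) (by simp),
      diskPoint_apply_ne_zero C e List.prefix_rfl _ _ (by simp)⟩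
  obtain ⟨x, hxO, W, ⟨hW, hWc⟩, hxW⟩ := Dense.inter_open_nonempty hf _ hO hOne
  have hV := (hW.inter hO).mem_nhds ⟨hxW, hxO⟩
  have hlim : Filter.Tendsto (fun n => truncL n x) Filter.atTop (𝓝 x) :=
    tendsto_subtype_rng.2 (tendsto_trunc x.1)
  obtain ⟨m, hmW, hmO⟩ := (hlim.eventually hV).exists
  -- A point of the open set with finite support lies on a disk, and can be moved along the
  -- Cantor set `K_t` to which this disk is attached.
  obtain ⟨t, ht, htm⟩ := (trunc_eq_zero_or x.1 m).resolve_left fun h0 => hmO (congrFun h0 u)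
  obtain ⟨d, hd, -⟩ := exists_truncL_eq_diskPoint C e x ht
  have hmd : truncL m x = diskPoint C e t d (x.1 t) (x.2.1 t) := (Subtype.ext htm).trans hd
  rw [hmd] at hmW hmO
  have hut : u <+: t := prefix_of_diskPoint_apply_ne_zero C e hmO
  have hcont := continuous_diskPoint C e t continuous_id (continuous_const (y := x.1 t))
    fun _ => x.2.1 t
  have hN := hcont.continuousAt.preimage_mem_nhds (hW.mem_nhds hmW)
  obtain ⟨d', hd', hdd'⟩ : ∃ d' ∈ _, d' ≠ d := by
    by_contra h
    push Not at h
    exact not_countable_of_mem_nhds_cantor hN ((countable_singleton d).mono h)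
  obtain ⟨q, hq, hqt⟩ := exists_truncL_diskPoint C e hut (x.1 t) (x.2.1 t)
  have hval : ∀ c, f (diskPoint C e t c (x.1 t) (x.2.1 t)) =
      f (diskPoint C e u (q c) 0 (by simp)) := fun c => by
    rw [hforget _ (diskPoint_apply_ne_zero C e hut _ _ ht), hqt]
  have heq := hWc _ hd' _ hmW
  simp only [id_eq] at heq
  rw [hval, hval] at heq
  exact hdd' (hq (hinj heq))

end Main

theorem theorem2p5 (ι : Type*) (hι : Cardinal.mk ι = Cardinal.continuum) :
    ∃ K : List ι → Set (TreeHilbert ι), IsCantorTree K ∧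
      (∀ s, ∀ v ∈ K s, ∀ z : ℂ, ‖z‖ ≤ (2⁻¹ : ℝ) ^ s.length → v + z • treeVec s ∈ LOmega K) ∧
      IsCompact (LOmegaWeak K) ∧
      FirstCountableTopology (LOmegaWeak K) ∧
      (∀ f ∈ EZero (LOmegaWeak K) ℝ, ∃ c : ℝ, ∀ x, f x = c) ∧
      ∀ (M : Type*) [TopologicalSpace M] [T2Space M],
        ∀ f ∈ EZero (LOmegaWeak K) M, ∃ c : M, ∀ x, f x = c := by
  obtain ⟨C⟩ := nonempty_curveSystem
  have hcard : Cardinal.lift.{0} (Cardinal.mk ι) = Cardinal.lift (Cardinal.mk Circle) := by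
    rw [hι, mk_circle, Cardinal.lift_continuum, Cardinal.lift_continuum]
  obtain ⟨e⟩ := Cardinal.lift_mk_eq'.1 hcard
  have hK : IsCantorTree (branchSet C e) := isCantorTree_range_branch C e
  have hc := isCompact_branchSet C e
  obtain ⟨h⟩ := nonempty_homeomorph_coordLOmega hc
  have hcpt : CompactSpace (coordLOmega (branchSet C e)) :=
    isCompact_iff_compactSpace.1 (isCompact_coordLOmega hc)
  have hcpt' : CompactSpace (LOmegaWeak (branchSet C e)) := h.compactSpace
  have hfc := firstCountable_coordLOmega hK hc
  let x₀ : LOmegaWeak (branchSet C e) := h (diskPoint C e [] (fun _ => true) 0 (by simp))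
  have hreal : ∀ f ∈ EZero (LOmegaWeak (branchSet C e)) ℝ, ∀ x y, f x = f y := by
    intro f hf x y
    have := eq_of_mem_EZero C e (EZero_comp_homeomorph h hf) (h.symm x) (h.symm y)
    simpa using this
  refine ⟨branchSet C e, hK, ?_, isCompact_iff_compactSpace.2 hcpt',
    h.symm.isInducing.firstCountableTopology, fun f hf => ⟨f x₀, fun x => hreal f hf x x₀⟩,
    fun M _ _ f hf => ⟨f x₀, fun x => eq_of_mem_EZero_of_real hreal hf x x₀⟩⟩
  rintro s _ ⟨c, rfl⟩ z hz
  exact branch_add_smul_mem_LOmega C e s c hz
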